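/- Let $\alpha,\beta>0$ with $\rho=\alpha/\beta<1$ and let $L\ge 1$ be an integer. For $k\ge 0$ put $\tilde u(k)=\rho^{1+L+\cdots+L^{k-1}}$ (so $\tilde u(0)=1$), and for $k\ge1$ let $\pi(k)=L^{k-1}\rho^{L+L^2+\cdots+L^{k-1}}$ (so $\pi(1)=1$) be the potential coefficients. Let $L_2(\pi)$ be the real Hilbert space of sequences $x=(x(k))_{k\ge0}$ with $x(0)=0$ and $\|x\|_{L_2(\pi)}^2=\sum_{k\ge1}x(k)^2\pi(k)^{-1}<\infty$, with scalar product $(x,y)_{L_2(\pi)}=\sum_{k\ge1}x(k)y(k)\pi(k)^{-1}$. Let $\mathcal K=\mathbf K(\tilde u)$ be given by $\mathcal Kx(0)=0$ and $$\mathcal Kx(k)=\alpha L\,\tilde u(k-1)^{L-1}x(k-1)-\bigl(\alpha L\,\tilde u(k)^{L-1}+\beta\bigr)x(k)+\beta x(k+1),\qquad k\ge1.$$ Then $\mathcal K$ is a bounded self-adjoint operator on $L_2(\pi)$. The spectrum of $-\mathcal K$ in $L_2(\pi)$ has a least point $\gamma$, and $0<\gamma\le\beta$. For every $z_0\in L_2(\pi)$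 the equation $\dot z_t=\mathcal Kz_t$, $t\ge0$, has in $L_2(\pi)$ the unique solution $z_t=\mathrm e^{\mathcal Kt}z_0$ starting at $z_0$, and $$\|z_t\|_{L_2(\pi)}\le \mathrm e^{-\gamma t}\|z_0\|_{L_2(\pi)},\qquad t\ge0.$$ -/

import Mathlib

namespace MeanFieldQueue

/-- A sequence of strictly positive weights `w(k)`, `k ≥ 1` (the value at `0` is irrelevant). -/
structure Weight where
  toFun : ℕ → ℝ
  pos : ∀ k, 1 ≤ k → 0 < toFun k

instance : CoeFun Weight (fun _ => ℕ → ℝ) := ⟨Weight.toFun⟩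

/-- Membership in `L₂(w)`: real sequences `(x(k))_{k ≥ 0}` with `x(0) = 0` and
`∑_{k ≥ 1} x(k)² w(k)⁻¹ < ∞`. -/
def MemL2 (w : Weight) (x : ℕ → ℝ) : Prop :=
  x 0 = 0 ∧ Summable fun k : ℕ => x (k + 1) ^ 2 / w (k + 1)

theorem Weight.pos_succ (w : Weight) (k : ℕ) : 0 < w (k + 1) := w.pos (k + 1) (Nat.le_add_left 1 k)

theorem MemL2.summable_mul {w : Weight} {x y : ℕ → ℝ} (hx : MemL2 w x) (hy : MemL2 w y) :
    Summable fun k : ℕ => x (k + 1) * y (k + 1) / w (k + 1) := by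
  refine Summable.of_norm_bounded (hx.2.add hy.2) fun k => ?_
  have hw := w.pos_succ k
  rw [Real.norm_eq_abs, abs_div, abs_of_pos hw, ← add_div]
  gcongr
  rw [abs_le]
  constructor <;> nlinarith [sq_nonneg (x (k + 1) + y (k + 1)), sq_nonneg (x (k + 1) - y (k + 1)),
    sq_nonneg (x (k + 1)), sq_nonneg (y (k + 1))]

/-- `L₂(w)` as a linear subspace of the space of real sequences. -/
def l2Submodule (w : Weight) : Submodule ℝ (ℕ → ℝ) where
  carrier := {x | MemL2 w x}
  zero_mem' := ⟨rfl, by simp [summable_zero]⟩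
  add_mem' := by
    intro x y hx hy
    refine ⟨by simp [hx.1, hy.1], ?_⟩
    refine ((hx.2.add hy.2).add ((hx.summable_mul hy).mul_left 2)).congr fun k => ?_
    simp only [Pi.add_apply]
    ring
  smul_mem' := by
    intro c x hx
    refine ⟨by simp [hx.1], ?_⟩
    refine (hx.2.mul_left (c ^ 2)).congr fun k => ?_
    simp only [Pi.smul_apply, smul_eq_mul]
    ring

/-- The scalar product `(x, y)_{L₂(w)} = ∑_{k ≥ 1} x(k) y(k) w(k)⁻¹`. -/
@[reducible]
noncomputable def l2Core (w : Weight) : InnerProductSpace.Core ℝ (l2Submodule w) where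
  inner x y := ∑' k : ℕ, x.1 (k + 1) * y.1 (k + 1) / w (k + 1)
  conj_inner_symm x y := by
    simp only [conj_trivial]
    exact tsum_congr fun k => by ring
  re_inner_nonneg x := by
    simp only [RCLike.re_to_real]
    exact tsum_nonneg fun k => div_nonneg (mul_self_nonneg _) (w.pos_succ k).le
  add_left x y z := by
    rw [← (MemL2.summable_mul x.2 z.2).tsum_add (MemL2.summable_mul y.2 z.2)]
    exact tsum_congr fun k => by
      rw [Submodule.coe_add, Pi.add_apply]; ring
  smul_left x y c := by
    simp only [conj_trivial]
    rw [← tsum_mul_left]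
    exact tsum_congr fun k => by
      rw [Submodule.coe_smul, Pi.smul_apply, smul_eq_mul]; ring
  definite x h := by
    have hnn : ∀ k : ℕ, 0 ≤ x.1 (k + 1) * x.1 (k + 1) / w (k + 1) := fun k =>
      div_nonneg (mul_self_nonneg _) (w.pos_succ k).le
    have h0 := (hasSum_zero_iff_of_nonneg hnn).1 (h ▸ (MemL2.summable_mul x.2 x.2).hasSum)
    apply Subtype.ext
    funext k
    cases k with
    | zero => exact x.2.1
    | succ k =>
      have hk := congrFun h0 k
      simp only [Pi.zero_apply, div_eq_zero_iff, mul_self_eq_zero] at hk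
      exact hk.resolve_right (w.pos_succ k).ne'

/-- The space `L₂(w)`; its topology is the one of the weighted norm below, not the product one. -/
def L2 (w : Weight) : Type := l2Submodule w

namespace L2

variable {w : Weight}

noncomputable instance : NormedAddCommGroup (L2 w) :=
  @InnerProductSpace.Core.toNormedAddCommGroup ℝ (l2Submodule w) _ _ _ (l2Core w)

noncomputable instance : InnerProductSpace ℝ (L2 w) :=
  @InnerProductSpace.ofCore ℝ (l2Submodule w) _ _ _ (l2Core w).toCore

/-- The sequence underlying an element of `L₂(w)`. -/
def seq (x : L2 w) : ℕ → ℝ := Subtype.val (p := fun x => x ∈ l2Submodule w) x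

/-- The element of `L₂(w)` given by a sequence in it. -/
def mk (x : ℕ → ℝ) (hx : MemL2 w x) : L2 w :=
  Subtype.mk (p := fun x => x ∈ l2Submodule w) x hx

instance : CoeFun (L2 w) (fun _ => ℕ → ℝ) := ⟨seq⟩

theorem mem (x : L2 w) : MemL2 w x := Subtype.property (p := fun x => x ∈ l2Submodule w) x

theorem ext_seq {x y : L2 w} (h : ∀ k, x (k + 1) = y (k + 1)) : x = y := by
  apply Subtype.ext
  funext k
  cases k with
  | zero => exact x.mem.1.trans y.mem.1.symm
  | succ k => exact h k

theorem mk_apply (x : ℕ → ℝ) (hx : MemL2 w x) (k : ℕ) : mk x hx k = x k := rfl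

theorem add_apply (x y : L2 w) (k : ℕ) : (x + y) k = x k + y k := rfl

theorem smul_apply (c : ℝ) (x : L2 w) (k : ℕ) : (c • x) k = c * x k := rfl

theorem inner_def (x y : L2 w) :
    inner ℝ x y = ∑' k : ℕ, x (k + 1) * y (k + 1) / w (k + 1) := rfl

/-- `‖x‖²_{L₂(w)} = ∑_{k ≥ 1} x(k)² w(k)⁻¹`. -/
theorem norm_sq (x : L2 w) : ‖x‖ ^ 2 = ∑' k : ℕ, x (k + 1) ^ 2 / w (k + 1) := by
  rw [← real_inner_self_eq_norm_sq, inner_def]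
  exact tsum_congr fun k => by rw [sq]

theorem div_sqrt_sq (w : Weight) (a : ℝ) (k : ℕ) :
    (a / √(w (k + 1))) ^ 2 = a ^ 2 / w (k + 1) := by
  rw [div_pow, Real.sq_sqrt (w.pos_succ k).le]

/-- The isometry `x ↦ (x(k+1) w(k+1)^{-1/2})_{k ≥ 0}` of `L₂(w)` onto `ℓ₂`. -/
noncomputable def toLp (w : Weight) : L2 w ≃ₗᵢ[ℝ] lp (fun _ : ℕ => ℝ) 2 where
  toFun x := ⟨fun k => x (k + 1) / √(w (k + 1)), by
    refine memℓp_gen ?_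
    refine x.mem.2.congr fun k => ?_
    rw [← div_sqrt_sq]
    simp only [ENNReal.toReal_ofNat, Real.norm_eq_abs, Real.rpow_ofNat, sq_abs]⟩
  invFun y := mk (fun k => y (k - 1) * √(w k) * (if k = 0 then 0 else 1)) (by
    refine ⟨by simp, ?_⟩
    have hy := (lp.memℓp y).summable (by simp)
    refine hy.congr fun k => ?_
    have hw := w.pos_succ k
    simp [mul_pow, Real.sq_sqrt hw.le, hw.ne'])
  left_inv x := ext_seq fun k => by
    have hw := Real.sqrt_pos.2 (w.pos_succ k)
    simp [mk_apply, hw.ne']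
  right_inv y := by
    ext k
    have hw := Real.sqrt_pos.2 (w.pos_succ k)
    simp [mk_apply, hw.ne']
  map_add' x y := by
    ext k
    exact add_div _ _ _
  map_smul' c x := by
    ext k
    simp [smul_apply, mul_div_assoc]
  norm_map' x := by
    have h : ∀ a b : ℝ, 0 ≤ a → 0 ≤ b → a ^ 2 = b ^ 2 → a = b := fun a b ha hb hab =>
      (pow_left_inj₀ ha hb two_ne_zero).1 hab
    refine h _ _ (norm_nonneg _) (norm_nonneg _) ?_
    have := lp.norm_rpow_eq_tsum (p := 2) (by simp) (E := fun _ : ℕ => ℝ)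
      (⟨fun k => x (k + 1) / √(w (k + 1)), by
        refine memℓp_gen ?_
        refine x.mem.2.congr fun k => ?_
        rw [← div_sqrt_sq]
        simp only [ENNReal.toReal_ofNat, Real.norm_eq_abs, Real.rpow_ofNat, sq_abs]⟩)
    rw [norm_sq]
    change ‖(⟨fun k => x (k + 1) / √(w (k + 1)), _⟩ : lp (fun _ : ℕ => ℝ) 2)‖ ^ 2 = _
    simpa only [ENNReal.toReal_ofNat, Real.norm_eq_abs, Real.rpow_ofNat, sq_abs, div_sqrt_sq] using this

instance : CompleteSpace (L2 w) :=
  (completeSpace_congr (e := (toLp w).toEquiv) (toLp w).isometry.isUniformEmbedding).2 inferInstance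

end L2

/-- The operator `K(v)` on sequences:
`K(v)x(k) = αL v(k-1)^{L-1} x(k-1) - (αL v(k)^{L-1} + β) x(k) + β x(k+1)` for `k ≥ 1`, and
`K(v)x(0) = 0`. -/
noncomputable def opK (α β : ℝ) (L : ℕ) (v x : ℕ → ℝ) : ℕ → ℝ
  | 0 => 0
  | k + 1 => α * L * v k ^ (L - 1) * x k - (α * L * v (k + 1) ^ (L - 1) + β) * x (k + 1)
      + β * x (k + 2)

/-- The equilibrium `ũ(k) = ρ^{1 + L + ⋯ + L^{k-1}}`. -/
noncomputable def uTilde (ρ : ℝ) (L : ℕ) (k : ℕ) : ℝ := ρ ^ ∑ i ∈ Finset.range k, L ^ i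

/-- The potential coefficients `π(k) = L^{k-1} ρ^{L + L² + ⋯ + L^{k-1}}`, `k ≥ 1`; the exponent
is `(L^k - L)/(L - 1)` for `L ≥ 2` and `k - 1` for `L = 1`. -/
noncomputable def potential (ρ : ℝ) (L : ℕ) (hρ : 0 < ρ) (hL : 1 ≤ L) : Weight where
  toFun k := (L : ℝ) ^ (k - 1) * ρ ^ ∑ i ∈ Finset.Ico 1 k, L ^ i
  pos k _ := by
    have : (0 : ℝ) < L := by exact_mod_cast hL
    positivity

end MeanFieldQueue

/-! Birth rates `α L ũ(k)^(L-1)` and death rate `β` are in detailed balance with `π`, so `𝒦 = -β (1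
- T) (1 - T)*` with `T` the left shift on `L₂(π)`. This makes `𝒦` bounded and self-adjoint
(`opKL2_seq`, `isSelfAdjoint_opKL2`).

The ratios `π(k+1)/π(k) = L ρ^(L^k)` do not increase, so `π(k+n) ≤ π(n+1) π(k)` and `‖T^n‖² ≤
π(n+1)`, which is below 1 for some `n`. Hence `1 - T` is invertible and the form `(-𝒦x, x) = β ‖(1 -
T)* x‖²` is coercive. Its optimal lower bound `γ` is therefore positive, and it is the least point
of the spectrum. Testing on the solution of `(1 - T)* x₀ = e₁` gives `γ ≤ β`. The form bound makes
`e^(2γt) ‖z_t‖²` nonincreasing, which is the decay estimate. -/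

namespace MeanFieldQueue

/-! ### Quadratic forms and the bottom of the spectrum -/

section SelfAdjoint

variable {E : Type*} [NormedAddCommGroup E] [InnerProductSpace ℝ E]

/-- Generalised Cauchy–Schwarz inequality for a positive symmetric operator. -/
theorem norm_map_sq_le_of_inner_nonneg (P : E →L[ℝ] E) (hP : P.IsSymmetric)
    (hpos : ∀ x, 0 ≤ inner ℝ (P x) x) (x : E) :
    ‖P x‖ ^ 2 ≤ (‖P‖ + 1) * inner ℝ (P x) x := by
  have hM : 0 < ‖P‖ + 1 := by positivity
  -- A gradient step on the form; the `+ 1` keeps the step size defined when `P = 0`.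
  have h := hpos (x - (‖P‖ + 1)⁻¹ • P x)
  have hsymm : inner ℝ (P (P x)) x = ‖P x‖ ^ 2 := by
    rw [← real_inner_self_eq_norm_sq]
    exact hP (P x) x
  have hle : inner ℝ (P (P x)) (P x) ≤ (‖P‖ + 1) * ‖P x‖ ^ 2 := by
    have h1 := real_inner_le_norm (P (P x)) (P x)
    have h2 := mul_le_mul_of_nonneg_right (P.le_opNorm (P x)) (norm_nonneg (P x))
    nlinarith [sq_nonneg ‖P x‖]
  simp only [map_sub, map_smul, inner_sub_left, inner_sub_right, real_inner_smul_left,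
    real_inner_smul_right, hsymm, real_inner_self_eq_norm_sq] at h
  have h3 : (‖P‖ + 1)⁻¹ * ((‖P‖ + 1)⁻¹ * inner ℝ (P (P x)) (P x)) ≤ (‖P‖ + 1)⁻¹ * ‖P x‖ ^ 2 := by
    gcongr
    rw [inv_mul_le_iff₀ hM]
    exact hle
  have h4 : (‖P‖ + 1)⁻¹ * ‖P x‖ ^ 2 ≤ inner ℝ (P x) x := by linarith
  rwa [inv_mul_le_iff₀ hM] at h4

theorem isUnit_of_coercive [CompleteSpace E] (P : E →L[ℝ] E) {c : ℝ} (hc : 0 < c)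
    (h : ∀ x, c * ‖x‖ ^ 2 ≤ inner ℝ (P x) x) : IsUnit P := by
  refine P.isUnit_of_forall_le_norm_inner_map (c := ⟨c, hc.le⟩) hc fun x => ?_
  rw [mul_comm]
  exact (h x).trans (le_abs_self _)

theorem exists_pos_mul_norm_sq_le_of_isUnit {P : E →L[ℝ] E} (h : IsUnit P) :
    ∃ c : ℝ, 0 < c ∧ ∀ x, c * ‖x‖ ^ 2 ≤ ‖P x‖ ^ 2 := by
  obtain ⟨u, rfl⟩ := h
  set Q : E →L[ℝ] E := ((u⁻¹ : (E →L[ℝ] E)ˣ) : E →L[ℝ] E) with hQ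
  have hM : 0 < ‖Q‖ + 1 := by positivity
  refine ⟨((‖Q‖ + 1) ^ 2)⁻¹, by positivity, fun x => ?_⟩
  have hx : Q ((u : E →L[ℝ] E) x) = x := by
    rw [hQ, ← mul_apply_eq_comp, Units.inv_mul, one_apply_eq_self]
  rw [inv_mul_le_iff₀ (by positivity), ← mul_pow]
  gcongr
  calc ‖x‖ = ‖Q ((u : E →L[ℝ] E) x)‖ := by rw [hx]
    _ ≤ ‖Q‖ * ‖(u : E →L[ℝ] E) x‖ := Q.le_opNorm _
    _ ≤ (‖Q‖ + 1) * ‖(u : E →L[ℝ] E) x‖ := by gcongr; linarith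

variable [CompleteSpace E]

/-- The optimal lower bound of the quadratic form of a symmetric operator is the least point of
its spectrum. -/
theorem isLeast_spectrum_of_optimal {H : E →L[ℝ] E} (hH : H.IsSymmetric) {γ : ℝ}
    (hle : ∀ x, γ * ‖x‖ ^ 2 ≤ inner ℝ (H x) x)
    (hopt : ∀ c, γ < c → ∃ x, inner ℝ (H x) x < c * ‖x‖ ^ 2) :
    IsLeast (spectrum ℝ H) γ := by
  have hin : ∀ (c : ℝ) (x : E), inner ℝ ((H - algebraMap ℝ (E →L[ℝ] E) c) x) x
      = inner ℝ (H x) x - c * ‖x‖ ^ 2 := fun c x => by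
    rw [Algebra.algebraMap_eq_smul_one, sub_apply,
      smul_apply, one_apply_eq_self, inner_sub_left,
      real_inner_smul_left, real_inner_self_eq_norm_sq]
  constructor
  · rw [spectrum.mem_iff, IsUnit.sub_iff]
    intro hu
    set P := H - algebraMap ℝ (E →L[ℝ] E) γ with hPdef
    have hP : P.IsSymmetric := fun x y => by
      have := hH x y
      simp only [ContinuousLinearMap.coe_coe] at this ⊢
      simp only [hPdef, Algebra.algebraMap_eq_smul_one, sub_apply,
        smul_apply, one_apply_eq_self, inner_sub_left,
        inner_sub_right, real_inner_smul_left, real_inner_smul_right, this]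
    obtain ⟨c, hc, hcle⟩ := exists_pos_mul_norm_sq_le_of_isUnit hu
    have hM : 0 < ‖P‖ + 1 := by positivity
    -- If `P` were invertible, `c ‖x‖² ≤ ‖P x‖² ≤ (‖P‖ + 1) (P x, x)` would raise the lower bound
    -- `γ` by `c / (‖P‖ + 1)`.
    obtain ⟨x, hx⟩ := hopt (γ + c / (‖P‖ + 1)) (by linarith [div_pos hc hM])
    have h1 := norm_map_sq_le_of_inner_nonneg P hP
      (fun y => by rw [hin]; linarith [hle y]) x
    have h2 : inner ℝ (P x) x < c / (‖P‖ + 1) * ‖x‖ ^ 2 := by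
      rw [hin]; linarith
    have h3 := mul_lt_mul_of_pos_left h2 hM
    have h4 : (‖P‖ + 1) * (c / (‖P‖ + 1) * ‖x‖ ^ 2) = c * ‖x‖ ^ 2 := by
      field_simp
    linarith [hcle x]
  · intro c hc
    by_contra! hlt
    rw [spectrum.mem_iff, IsUnit.sub_iff] at hc
    refine hc (isUnit_of_coercive _ (sub_pos.2 hlt) fun x => ?_)
    rw [hin, sub_mul]
    linarith [hle x]

/-- `γ` is the supremum of all lower bounds of the form; the test vector `x₀` bounds them by `β`. -/
theorem exists_isLeast_spectrum {H : E →L[ℝ] E} (hH : H.IsSymmetric) {c β : ℝ}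
    (hc : ∀ x, c * ‖x‖ ^ 2 ≤ inner ℝ (H x) x) {x₀ : E} (hx₀ : x₀ ≠ 0)
    (hβ : inner ℝ (H x₀) x₀ ≤ β * ‖x₀‖ ^ 2) :
    ∃ γ, IsLeast (spectrum ℝ H) γ ∧ c ≤ γ ∧ γ ≤ β ∧ ∀ x, γ * ‖x‖ ^ 2 ≤ inner ℝ (H x) x := by
  set A : Set ℝ := {a | ∀ x, a * ‖x‖ ^ 2 ≤ inner ℝ (H x) x}
  have hbound : ∀ a ∈ A, a ≤ β := fun a ha => by
    have hpos : 0 < ‖x₀‖ ^ 2 := by positivity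
    exact le_of_mul_le_mul_right ((ha x₀).trans hβ) hpos
  have hbdd : BddAbove A := ⟨β, hbound⟩
  have hne : A.Nonempty := ⟨c, hc⟩
  have hmem : sSup A ∈ A := fun x => by
    rcases eq_or_ne x 0 with rfl | hx
    · simp
    have hpos : 0 < ‖x‖ ^ 2 := by positivity
    rw [← le_div_iff₀ hpos]
    exact csSup_le hne fun a ha => (le_div_iff₀ hpos).2 (ha x)
  refine ⟨sSup A, isLeast_spectrum_of_optimal hH hmem fun a ha => ?_, le_csSup hbdd hc,
    hbound _ hmem, hmem⟩
  by_contra! hcon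
  exact ha.not_ge (le_csSup hbdd hcon)

end SelfAdjoint

/-! ### The linear flow: uniqueness and decay -/

section Exponential

variable {E : Type*} [NormedAddCommGroup E]

theorem hasDerivAt_exp_smul_apply [NormedSpace ℝ E] [CompleteSpace E] (K : E →L[ℝ] E) (z₀ : E)
    (t : ℝ) : HasDerivAt (fun s : ℝ => NormedSpace.exp (s • K) z₀)
      (K (NormedSpace.exp (t • K) z₀)) t :=
  (hasDerivAt_exp_smul_const' (𝕂 := ℝ) K t).clm_apply (hasDerivAt_const t z₀) |>.congr_deriv
    (by simp)

theorem eq_exp_smul_apply_of_hasDerivWithinAt [NormedSpace ℝ E] [CompleteSpace E] (K : E →L[ℝ] E)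
    {z : ℝ → E} (hz : ∀ t, 0 ≤ t → HasDerivWithinAt z (K (z t)) (Set.Ici 0) t) {t : ℝ}
    (ht : 0 ≤ t) : z t = NormedSpace.exp (t • K) (z 0) := by
  refine ODE_solution_unique (v := fun _ x => K x) (a := 0) (b := t) (K := ‖K‖₊)
    (fun _ => K.lipschitz)
    (fun s hs => (hz s hs.1).continuousWithinAt.mono Set.Icc_subset_Ici_self)
    (fun s hs => (hz s hs.1).mono (Set.Ici_subset_Ici.2 hs.1))
    (fun s _ => (hasDerivAt_exp_smul_apply K (z 0) s).continuousAt.continuousWithinAt)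
    (fun s _ => (hasDerivAt_exp_smul_apply K (z 0) s).hasDerivWithinAt) (by simp)
    (Set.right_mem_Icc.2 ht)

/-- The derivative of `e^(2γs) ‖z s‖²` is `2 e^(2γs) (γ ‖z s‖² + (z s, K (z s)))`, which is
nonpositive by `hK`. -/
theorem norm_exp_smul_apply_le [InnerProductSpace ℝ E] [CompleteSpace E] {K : E →L[ℝ] E} {γ : ℝ}
    (hK : ∀ x, γ * ‖x‖ ^ 2 ≤ inner ℝ ((-K) x) x) (z₀ : E) {t : ℝ} (ht : 0 ≤ t) :
    ‖NormedSpace.exp (t • K) z₀‖ ≤ Real.exp (-γ * t) * ‖z₀‖ := by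
  set z : ℝ → E := fun s => NormedSpace.exp (s • K) z₀ with hzdef
  have hz : ∀ s, HasDerivAt z (K (z s)) s := hasDerivAt_exp_smul_apply K z₀
  have hd : ∀ s, HasDerivAt (fun s => Real.exp (2 * γ * s) * ‖z s‖ ^ 2)
      (Real.exp (2 * γ * s) * (2 * γ) * ‖z s‖ ^ 2
        + Real.exp (2 * γ * s) * (2 * inner ℝ (z s) (K (z s)))) s := fun s =>
    (((hasDerivAt_id s).const_mul (2 * γ)).exp.congr_deriv (by simp)).mul (hz s).norm_sq
  have hanti : Antitone fun s => Real.exp (2 * γ * s) * ‖z s‖ ^ 2 := by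
    refine antitone_of_hasDerivAt_nonpos hd fun s => ?_
    have h := hK (z s)
    rw [neg_apply, inner_neg_left, real_inner_comm] at h
    rw [Pi.zero_apply]
    have := mul_nonneg (Real.exp_pos (2 * γ * s)).le (by linarith :
      0 ≤ -(γ * ‖z s‖ ^ 2 + inner ℝ (z s) (K (z s))))
    linarith
  have h := hanti ht
  simp only [mul_zero, Real.exp_zero, one_mul] at h
  have hz0 : z 0 = z₀ := by simp [hzdef]
  rw [hz0] at h
  refine le_of_sq_le_sq ?_ (by positivity)
  have he : Real.exp (2 * γ * t) * Real.exp (-γ * t) ^ 2 = 1 := by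
    rw [sq, ← Real.exp_add, ← Real.exp_add]
    ring_nf
    exact Real.exp_zero
  refine le_of_mul_le_mul_left (h.trans_eq ?_) (Real.exp_pos (2 * γ * t))
  rw [mul_pow, ← mul_assoc, he, one_mul]

end Exponential

/-! ### The left shift on `L₂(w)` and its adjoint -/

namespace L2

variable {w : Weight}

theorem sub_apply (x y : L2 w) (k : ℕ) : (x - y) k = x k - y k := rfl

theorem memL2_single (w : Weight) (k : ℕ) : MemL2 w (Pi.single (k + 1) 1) := by
  refine ⟨by simp, summable_of_ne_finset_zero (s := {k}) fun j hj => ?_⟩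
  have : j + 1 ≠ k + 1 := by simpa using hj
  simp [Pi.single_eq_of_ne this]

/-- The basis sequence supported at `k + 1`. -/
noncomputable def single (w : Weight) (k : ℕ) : L2 w :=
  mk (Pi.single (k + 1) 1) (memL2_single w k)

theorem single_apply (k j : ℕ) : single w k (j + 1) = if j = k then 1 else 0 := by
  rw [single, mk_apply, Pi.single_apply]
  simp

theorem inner_single_left (k : ℕ) (x : L2 w) :
    inner ℝ (single w k) x = x (k + 1) / w (k + 1) := by
  rw [inner_def, tsum_eq_single k fun j hj => by simp [single_apply, hj]]
  simp [single_apply]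

theorem sq_div_le_norm_sq (x : L2 w) (k : ℕ) : x (k + 1) ^ 2 / w (k + 1) ≤ ‖x‖ ^ 2 := by
  rw [norm_sq]
  exact x.mem.2.le_tsum k fun j _ => div_nonneg (sq_nonneg _) (w.pos_succ j).le

/-- Weights enter the norm as reciprocals, so their decay makes shifting left contractive. Used with
`n = 1` to bound `T`, and with `D < 1` for a power of `T`. -/
theorem norm_sq_le_of_shift {D : ℝ} {n : ℕ} (hD : ∀ k, w (k + 1 + n) ≤ D * w (k + 1))
    {x y : L2 w} (hxy : ∀ k, y (k + 1) = x (k + 1 + n)) : ‖y‖ ^ 2 ≤ D * ‖x‖ ^ 2 := by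
  have hD0 : 0 ≤ D :=
    (pos_of_mul_pos_left ((w.pos (0 + 1 + n) (by lia)).trans_le (hD 0)) (w.pos_succ 0).le).le
  have hsum : Summable fun k => x (k + n + 1) ^ 2 / w (k + n + 1) :=
    (summable_nat_add_iff n).2 x.mem.2
  calc ‖y‖ ^ 2 = ∑' k, y (k + 1) ^ 2 / w (k + 1) := norm_sq y
    _ ≤ ∑' k, D * (x (k + n + 1) ^ 2 / w (k + n + 1)) := by
        refine y.mem.2.tsum_le_tsum (fun k => ?_) (hsum.mul_left D)
        have hk := hD k
        have h1 := w.pos_succ k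
        have h2 := w.pos_succ (k + n)
        rw [hxy, show k + 1 + n = k + n + 1 by ring] at *
        rw [← mul_div_assoc, div_le_div_iff₀ h1 h2]
        nlinarith [sq_nonneg (x (k + n + 1))]
    _ = D * ∑' k, x (k + n + 1) ^ 2 / w (k + n + 1) := tsum_mul_left
    _ ≤ D * ‖x‖ ^ 2 := by
        rw [norm_sq]
        refine mul_le_mul_of_nonneg_left ?_ hD0
        rw [← x.mem.2.sum_add_tsum_nat_add n]
        exact le_add_of_nonneg_left
          (Finset.sum_nonneg fun j _ => div_nonneg (sq_nonneg _) (w.pos_succ j).le)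

theorem memL2_shift {C : ℝ} (hC : ∀ k, w (k + 2) ≤ C * w (k + 1)) (x : L2 w) :
    MemL2 w fun k => if k = 0 then 0 else x (k + 1) := by
  refine ⟨by simp, ?_⟩
  have hs : Summable fun k => C * (x (k + 2) ^ 2 / w (k + 2)) :=
    ((summable_nat_add_iff 1).2 x.mem.2).mul_left C
  refine hs.of_nonneg_of_le (fun k => div_nonneg (sq_nonneg _) (w.pos_succ k).le) fun k => ?_
  have hk := hC k
  have h1 := w.pos_succ k
  have h2 := w.pos_succ (k + 1)
  simp only [Nat.add_eq_zero_iff, one_ne_zero, and_false, if_false]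
  rw [← mul_div_assoc, div_le_div_iff₀ h1 h2]
  nlinarith [sq_nonneg (x (k + 2))]

/-- The left shift `x ↦ (0, x(2), x(3), …)`, bounded if the ratios `w(k+1)/w(k)` are. -/
noncomputable def shift {C : ℝ} (hC : ∀ k, w (k + 2) ≤ C * w (k + 1)) : L2 w →L[ℝ] L2 w :=
  LinearMap.mkContinuous
    { toFun := fun x => mk _ (memL2_shift hC x)
      map_add' := fun x y => ext_seq fun k => by simp [mk_apply, add_apply]
      map_smul' := fun c x => ext_seq fun k => by simp [mk_apply, smul_apply] }
    √C fun x => by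
      refine le_of_sq_le_sq ?_ (by positivity)
      have hC0 : 0 ≤ C :=
        (pos_of_mul_pos_left ((w.pos_succ 1).trans_le (hC 0)) (w.pos_succ 0).le).le
      rw [mul_pow, Real.sq_sqrt hC0]
      exact norm_sq_le_of_shift (n := 1) hC fun k => by simp [mk_apply]

variable {C : ℝ} (hC : ∀ k, w (k + 2) ≤ C * w (k + 1))

theorem shift_apply (x : L2 w) (k : ℕ) : shift hC x (k + 1) = x (k + 2) := by
  simp [shift, mk_apply]

theorem shift_pow_apply (n : ℕ) (x : L2 w) (k : ℕ) :
    (shift hC ^ n) x (k + 1) = x (k + 1 + n) := by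
  induction n generalizing x with
  | zero => simp
  | succ n ih =>
    rw [pow_succ, mul_apply_eq_comp, ih, show k + 1 + n = k + n + 1 by ring,
      shift_apply]
    congr 1
    ring

theorem shift_single_zero : shift hC (single w 0) = 0 :=
  ext_seq fun k => by
    rw [shift_apply, single_apply]
    simp
    rfl

theorem shift_single_succ (k : ℕ) : shift hC (single w (k + 1)) = single w k :=
  ext_seq fun j => by rw [shift_apply, single_apply, single_apply]; simp

theorem adjoint_shift_apply_one (x : L2 w) :
    (ContinuousLinearMap.adjoint (shift hC) x) 1 = 0 := by
  have h := inner_single_left 0 (ContinuousLinearMap.adjoint (shift hC) x)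
  rw [ContinuousLinearMap.adjoint_inner_right, shift_single_zero, inner_zero_left] at h
  exact (div_eq_zero_iff.1 h.symm).resolve_right (w.pos_succ 0).ne'

/-- Coordinates are scalar products with basis vectors, and `T` moves each basis vector down by one;
the weight ratio comes from their different norms. -/
theorem adjoint_shift_apply_add_two (x : L2 w) (k : ℕ) :
    (ContinuousLinearMap.adjoint (shift hC) x) (k + 2) = w (k + 2) / w (k + 1) * x (k + 1) := by
  have h := inner_single_left (k + 1) (ContinuousLinearMap.adjoint (shift hC) x)
  rw [ContinuousLinearMap.adjoint_inner_right, shift_single_succ, inner_single_left] at h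
  have h2 := (w.pos_succ (k + 1)).ne'
  rw [eq_div_iff h2] at h
  rw [← h]
  ring

/-- `T` itself need not contract: for `π`, `‖T‖² = L ρ^L` may exceed 1. It suffices that `1 - T^n`
is invertible, since `1 - T` is one of its commuting factors. -/
theorem isUnit_one_sub_shift {D : ℝ} {n : ℕ} (hD1 : D < 1)
    (hD : ∀ k, w (k + 1 + n) ≤ D * w (k + 1)) : IsUnit (1 - shift hC) := by
  have hD0 : 0 ≤ D :=
    (pos_of_mul_pos_left ((w.pos (0 + 1 + n) (by lia)).trans_le (hD 0)) (w.pos_succ 0).le).le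
  have hnorm : ‖shift hC ^ n‖ < 1 := by
    refine (ContinuousLinearMap.opNorm_le_bound _ (Real.sqrt_nonneg D) fun x => ?_).trans_lt
      ((Real.sqrt_lt' one_pos).2 (by simpa using hD1))
    refine le_of_sq_le_sq ?_ (by positivity)
    rw [mul_pow, Real.sq_sqrt hD0]
    exact norm_sq_le_of_shift hD (shift_pow_apply hC n x)
  have hu := isUnit_one_sub_of_norm_lt_one hnorm
  rw [← mul_neg_geom_sum] at hu
  have hcomm : Commute (1 - shift hC) (∑ i ∈ Finset.range n, shift hC ^ i) :=
    Commute.sum_right _ _ _ fun i _ =>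
      (Commute.one_left _).sub_left ((Commute.refl _).pow_right i)
  exact (hcomm.isUnit_mul_iff.1 hu).1

end L2

/-! ### Growth and decay of the potential coefficients -/

section Potential

variable {ρ : ℝ} {L : ℕ} (hρ : 0 < ρ) (hL : 1 ≤ L)

theorem potential_apply (k : ℕ) :
    potential ρ L hρ hL k = (L : ℝ) ^ (k - 1) * ρ ^ ∑ i ∈ Finset.Ico 1 k, L ^ i := rfl

theorem potential_one : potential ρ L hρ hL 1 = 1 := by simp [potential_apply]

theorem potential_add_two (k : ℕ) :
    potential ρ L hρ hL (k + 2) = L * ρ ^ L ^ (k + 1) * potential ρ L hρ hL (k + 1) := by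
  rw [potential_apply, potential_apply, Finset.sum_Ico_succ_top (by lia), pow_add]
  simp only [Nat.add_sub_cancel, show k + 2 - 1 = k + 1 by lia, pow_succ (L : ℝ) k]
  ring

/-- The ratio of consecutive coefficients is nonincreasing, so `n` steps from `k + 1` gain at most
what `n` steps from `1` do. -/
theorem potential_add_le (hρ1 : ρ ≤ 1) (n k : ℕ) :
    potential ρ L hρ hL (k + 1 + n)
      ≤ potential ρ L hρ hL (n + 1) * potential ρ L hρ hL (k + 1) := by
  induction n with
  | zero => simp [potential_one]
  | succ n ih =>
    rw [show k + 1 + (n + 1) = (k + n) + 2 by ring, potential_add_two, potential_add_two,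
      mul_assoc _ (potential ρ L hρ hL (n + 1))]
    rw [show k + 1 + n = k + n + 1 by ring] at ih
    have h : ρ ^ L ^ (k + n + 1) ≤ ρ ^ L ^ (n + 1) :=
      pow_le_pow_of_le_one hρ.le hρ1 (Nat.pow_le_pow_right hL (by lia))
    have h' := (potential ρ L hρ hL).pos_succ (k + n)
    gcongr

theorem exists_potential_lt_one (hρ1 : ρ < 1) : ∃ n, potential ρ L hρ hL (n + 1) < 1 := by
  rcases hL.eq_or_lt with rfl | hL2
  · exact ⟨1, by simpa [potential_apply] using hρ1⟩
  have htend : Filter.Tendsto (fun n => ((L ^ n : ℕ) : ℝ) * ρ ^ L ^ n) Filter.atTop (nhds 0) :=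
    (tendsto_self_mul_const_pow_of_lt_one hρ.le hρ1).comp
      (tendsto_pow_atTop_atTop_of_one_lt hL2)
  obtain ⟨n, hn, hn1⟩ :=
    ((htend.eventually_lt_const one_pos).and (Filter.eventually_ge_atTop 1)).exists
  refine ⟨n, lt_of_le_of_lt ?_ hn⟩
  rw [potential_apply, Nat.add_sub_cancel, Nat.cast_pow]
  gcongr ?_ * ?_
  -- Only the top term `L^n` of the exponent is kept; it is present because `n ≥ 1`.
  exact pow_le_pow_of_le_one hρ.le hρ1.le (Finset.single_le_sum (f := fun i => L ^ i)
    (fun i _ => Nat.zero_le _) (Finset.mem_Ico.2 ⟨hn1, by lia⟩))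

theorem potential_shift_le (hρ1 : ρ ≤ 1) (k : ℕ) :
    potential ρ L hρ hL (k + 2) ≤ potential ρ L hρ hL 2 * potential ρ L hρ hL (k + 1) :=
  potential_add_le hρ hL hρ1 1 k

/-- The exponent telescopes: `(L - 1)(1 + L + ⋯ + L^(k-1)) + 1 = L^k`. -/
theorem mul_uTilde_pow {ρ : ℝ} {L : ℕ} (hL : 1 ≤ L) (k : ℕ) : ρ * uTilde ρ L k ^ (L - 1) = ρ ^ L ^ k := by
  rw [uTilde, ← pow_mul, ← pow_succ', geom_sum_mul_of_one_le hL, Nat.sub_add_cancel (Nat.one_le_pow _ _ hL)]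

end Potential

/-- The factorisation `𝒦 = -β (1 - T) (1 - T)*`, where `T` is the left shift. -/
noncomputable def opKL2 (β : ℝ) {w : Weight} {C : ℝ} (hC : ∀ k, w (k + 2) ≤ C * w (k + 1)) :
    L2 w →L[ℝ] L2 w :=
  -(β • ((1 - L2.shift hC) * ContinuousLinearMap.adjoint (1 - L2.shift hC)))

/-! ### The factorised operator and its spectral gap -/

section OpK

variable {β C : ℝ} {w : Weight} (hC : ∀ k, w (k + 2) ≤ C * w (k + 1))

theorem inner_neg_opKL2 (x y : L2 w) : inner ℝ ((-opKL2 β hC) x) y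
    = β * inner ℝ (ContinuousLinearMap.adjoint (1 - L2.shift hC) x)
      (ContinuousLinearMap.adjoint (1 - L2.shift hC) y) := by
  rw [opKL2, neg_neg, smul_apply, real_inner_smul_left,
    mul_apply_eq_comp, ContinuousLinearMap.adjoint_inner_right]

theorem isSymmetric_neg_opKL2 : (-opKL2 β hC).IsSymmetric := fun x y => by
  simp only [ContinuousLinearMap.coe_coe]
  rw [inner_neg_opKL2, real_inner_comm _ x, inner_neg_opKL2, real_inner_comm]

theorem isSelfAdjoint_opKL2 : IsSelfAdjoint (opKL2 β hC) := by
  have h := (ContinuousLinearMap.isSelfAdjoint_iff_isSymmetric.2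
    (isSymmetric_neg_opKL2 (β := β) hC)).neg
  rwa [neg_neg] at h

theorem adjoint_one_sub_shift_apply (x : L2 w) (k : ℕ) :
    (ContinuousLinearMap.adjoint (1 - L2.shift hC) x).seq k
      = x k - (ContinuousLinearMap.adjoint (L2.shift hC) x) k := by
  rw [map_sub]
  simp [← ContinuousLinearMap.star_eq_adjoint, L2.sub_apply]

theorem opKL2_apply (x : L2 w) (k : ℕ) : opKL2 β hC x (k + 1)
    = β * (x (k + 2) - w (k + 2) / w (k + 1) * x (k + 1)
      - (x (k + 1) - (ContinuousLinearMap.adjoint (L2.shift hC) x) (k + 1))) := by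
  rw [opKL2, ← smul_neg, smul_apply, L2.smul_apply, neg_mul_eq_neg_mul,
    neg_sub, mul_apply_eq_comp, sub_apply,
    one_apply_eq_self, L2.sub_apply, L2.shift_apply, adjoint_one_sub_shift_apply,
    adjoint_one_sub_shift_apply, L2.adjoint_shift_apply_add_two]

theorem exists_isLeast_spectrum_neg_opKL2 (hβ : 0 < β) (hu : IsUnit (1 - L2.shift hC)) :
    ∃ γ, IsLeast (spectrum ℝ (-opKL2 β hC)) γ ∧ 0 < γ ∧ γ ≤ β ∧
      ∀ x, γ * ‖x‖ ^ 2 ≤ inner ℝ ((-opKL2 β hC) x) x := by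
  have hu' : IsUnit (ContinuousLinearMap.adjoint (1 - L2.shift hC)) := by
    rw [← ContinuousLinearMap.star_eq_adjoint]
    exact hu.star
  obtain ⟨c, hc, hcle⟩ := exists_pos_mul_norm_sq_le_of_isUnit hu'
  -- Since `T* x₀` vanishes at 1, `x₀(1) = 1`, so `‖x₀‖ ≥ ‖e₁‖` while the form at `x₀` equals `β
  -- ‖e₁‖²`.
  obtain ⟨x₀, hx₀⟩ := (ContinuousLinearMap.isUnit_iff_bijective.1 hu').2 (L2.single w 0)
  have hx1 : x₀ (0 + 1) = 1 := by
    have h := congrArg (fun y : L2 w => y (0 + 1)) hx₀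
    simp only [adjoint_one_sub_shift_apply, L2.single_apply] at h
    simpa [L2.adjoint_shift_apply_one hC x₀] using h
  have hnorm : ‖L2.single w 0‖ ^ 2 ≤ ‖x₀‖ ^ 2 := by
    rw [← real_inner_self_eq_norm_sq, L2.inner_single_left, L2.single_apply]
    simpa [hx1] using L2.sq_div_le_norm_sq x₀ 0
  have hne : x₀ ≠ 0 := by
    rintro rfl
    exact zero_ne_one hx1
  obtain ⟨γ, hγ, hcγ, hγβ, hle⟩ := exists_isLeast_spectrum (isSymmetric_neg_opKL2 (β := β) hC)
    (c := β * c) (β := β) (fun x => by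
      rw [inner_neg_opKL2, real_inner_self_eq_norm_sq, mul_assoc]
      gcongr
      exact hcle x) hne (by
      rw [inner_neg_opKL2, real_inner_self_eq_norm_sq, hx₀]
      gcongr)
  exact ⟨γ, hγ, (mul_pos hβ hc).trans_le hcγ, hγβ, hle⟩

end OpK

/-- Detailed balance: `α L ũ(k)^(L-1) = β π(k+1)/π(k)` for `k ≥ 1`. -/
theorem opKL2_seq {α β : ℝ} {L : ℕ} (hα : 0 < α) (hβ : 0 < β) (hL : 1 ≤ L) {C : ℝ}
    (hC : ∀ k, potential (α / β) L (div_pos hα hβ) hL (k + 2)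
      ≤ C * potential (α / β) L (div_pos hα hβ) hL (k + 1))
    (x : L2 (potential (α / β) L (div_pos hα hβ) hL)) :
    (opKL2 β hC x).seq = opK α β L (uTilde (α / β) L) x.seq := by
  have hrate : ∀ k, potential (α / β) L (div_pos hα hβ) hL (k + 2)
      / potential (α / β) L (div_pos hα hβ) hL (k + 1) = L * (α / β) ^ L ^ (k + 1) := fun k => by
    rw [potential_add_two, mul_div_cancel_right₀ _ (Weight.pos_succ _ k).ne']
  have hcoef : ∀ k, α * L * uTilde (α / β) L k ^ (L - 1) = β * (L * (α / β) ^ L ^ k) := fun k => by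
    rw [← mul_uTilde_pow hL]
    field_simp
  funext k
  rcases k with _ | _ | k
  · exact (opKL2 β hC x).mem.1
  -- At the boundary the rate at `0` has no matching ratio of `π`; it is killed by `x(0) = 0`, just
  -- as `T* x` vanishes at 1.
  · rw [opKL2_apply, hrate, L2.adjoint_shift_apply_one, opK, hcoef, hcoef, x.mem.1]
    ring
  · rw [opKL2_apply, hrate, L2.adjoint_shift_apply_add_two, hrate, opK, hcoef, hcoef]
    ring

end MeanFieldQueue

open MeanFieldQueue in
theorem theorem2p7 (α β : ℝ) (L : ℕ) (hα : 0 < α) (hβ : 0 < β) (hαβ : α / β < 1) (hL : 1 ≤ L) :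
    ∃ 𝒦 : L2 (potential (α / β) L (div_pos hα hβ) hL) →L[ℝ]
        L2 (potential (α / β) L (div_pos hα hβ) hL),
      (∀ x, (𝒦 x).seq = opK α β L (uTilde (α / β) L) x.seq) ∧
      IsSelfAdjoint 𝒦 ∧
      ∃ γ : ℝ, IsLeast (spectrum ℝ (-𝒦)) γ ∧ 0 < γ ∧ γ ≤ β ∧
        ∀ z₀ : L2 (potential (α / β) L (div_pos hα hβ) hL),
          (∀ t : ℝ, 0 ≤ t → HasDerivWithinAt (fun s : ℝ => NormedSpace.exp (s • 𝒦) z₀)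
            (𝒦 (NormedSpace.exp (t • 𝒦) z₀)) (Set.Ici 0) t) ∧
          (∀ z : ℝ → L2 (potential (α / β) L (div_pos hα hβ) hL), z 0 = z₀ →
            (∀ t : ℝ, 0 ≤ t → HasDerivWithinAt z (𝒦 (z t)) (Set.Ici 0) t) →
            ∀ t : ℝ, 0 ≤ t → z t = NormedSpace.exp (t • 𝒦) z₀) ∧
          ∀ t : ℝ, 0 ≤ t → ‖NormedSpace.exp (t • 𝒦) z₀‖ ≤ Real.exp (-γ * t) * ‖z₀‖ := by
  have hρ := div_pos hα hβ
  have hC := potential_shift_le hρ hL hαβ.le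
  obtain ⟨n, hn⟩ := exists_potential_lt_one hρ hL hαβ
  obtain ⟨γ, hγ, hγ0, hγβ, hle⟩ := exists_isLeast_spectrum_neg_opKL2 hC hβ
    (L2.isUnit_one_sub_shift hC hn (potential_add_le hρ hL hαβ.le n))
  refine ⟨opKL2 β hC, opKL2_seq hα hβ hL hC, isSelfAdjoint_opKL2 hC, γ, hγ, hγ0, hγβ,
    fun z₀ => ⟨fun t _ => (hasDerivAt_exp_smul_apply _ z₀ t).hasDerivWithinAt, ?_,
      fun t ht => norm_exp_smul_apply_le hle z₀ ht⟩⟩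
  rintro z rfl hz t ht
  exact eq_exp_smul_apply_of_hasDerivWithinAt _ hz ht
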